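/- **Rosenberg's Theorem on minimal clones.** Let $A$ be a (finite or infinite) set with $|A|\ge 2$. An operation on $A$ is a map $f\colon A^n\to A$ with $n\ge 1$. A clone on $A$ is a set of operations on $A$ that contains all projections and is closed under composition; the clone generated by $f$ is the least clone containing $f$. A clone is minimal if it has exactly one proper subclone, namely the clone of projections. A ternary operation $f$ is a minority operation if $f(x,y,y)=f(y,x,y)=f(y,y,x)=x$ for all $x,y\in A$, and a majority operation if $f(x,x,y)=f(x,y,x)=f(y,x,x)=x$ for all $x,y\in A$. An $n$-ary operation $f$ is a semiprojection onto its first variable if $n\ge 3$, $f$ is not a projection, and $f(y_1,\dots,y_n)=y_1$ whenever $y_i=y_j$ for some $i\ne j$. An elementary abelian $2$-group is an abelian group $(A;+)$ with $x+x=0$ for all $x\in A$. A minority operation $f$ on $A$ generates a minimal clone if and only if $f$ is the ternary addition $x_1+x_2+x_3$ of some elementary abelian $2$-group $(A;+)$ on the set $A$. Moreover, every minimal clone on $A$ is generated by an operation $f$ of one of the following types: - (I) $f$ is a unary operation such that either $f\circ f=f$ and $f(A)\neq A$, or $f$ is a permutation of prime order; - (II) $f$ is a binary idempotent operation (that is,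 $f(x,x)=x$ for all $x\in A$) that is not a projection; - (III) $f$ is a semiprojection onto its first variable; - (IV) $f$ is a majority operation; - (V) $f$ is the ternary addition $x_1+x_2+x_3$ of some elementary abelian $2$-group $(A;+)$ on $A$. Every operation of type (I) or (V) generates a minimal clone. -/

import Mathlib

/-- The `n`-ary operations on `A`. -/
abbrev Operation (A : Type*) (n : ℕ) : Type _ := (Fin n → A) → A

namespace Operation

variable {A : Type*} {n : ℕ}

/-- The `n`-ary projection onto the `i`-th variable. -/
def proj (A : Type*) {n : ℕ} (i : Fin n) : Operation A n := fun a => a i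

/-- The composition `f(g₁, …, gₙ)` of an `n`-ary operation with `n` operations of arity `m`. -/
def comp {m : ℕ} (f : Operation A n) (g : Fin n → Operation A m) : Operation A m :=
  fun a => f (fun i => g i a)

/-- `f` is a projection. -/
def IsProjection (f : Operation A n) : Prop := ∃ i : Fin n, f = proj A i

/-- `f(x, …, x) = x`. -/
def IsIdempotent (f : Operation A n) : Prop := ∀ x : A, f (fun _ => x) = x

/-- `f` is an `n`-ary semiprojection onto the `i`-th variable: `n ≥ 3`, `f` is not a projection,
and `f(y₁, …, yₙ) = yᵢ` whenever two of `y₁, …, yₙ` are equal. -/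
def IsSemiprojection (f : Operation A n) (i : Fin n) : Prop :=
  3 ≤ n ∧ ¬ f.IsProjection ∧
    ∀ y : Fin n → A, (∃ j k : Fin n, j ≠ k ∧ y j = y k) → f y = y i

/-- `f(x, x, y) = f(x, y, x) = f(y, x, x) = x`. -/
def IsMajority (f : Operation A 3) : Prop :=
  ∀ x y : A, f ![x, x, y] = x ∧ f ![x, y, x] = x ∧ f ![y, x, x] = x

/-- `f(x, y, y) = f(y, x, y) = f(y, y, x) = x`. -/
def IsMinority (f : Operation A 3) : Prop :=
  ∀ x y : A, f ![x, y, y] = x ∧ f ![y, x, y] = x ∧ f ![y, y, x] = x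

/-- The map `A → A` given by a unary operation. -/
def toMap (f : Operation A 1) : A → A := fun a => f ![a]

/-- `f` is a unary operation with `f² = f` and `f(A) ≠ A`, or a permutation of prime order. -/
def IsUnaryRetractionOrPrimePerm (f : Operation A 1) : Prop :=
  (f.toMap ∘ f.toMap = f.toMap ∧ Set.range f.toMap ≠ Set.univ) ∨
    ∃ σ : Equiv.Perm A, (⇑σ = f.toMap) ∧ (orderOf σ).Prime

/-- `f` is the ternary addition `x₁ + x₂ + x₃` of some elementary abelian 2-group on `A`. -/
def IsElementaryTwoGroupAddition (f : Operation A 3) : Prop :=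
  ∃ _ : AddCommGroup A, (∀ x : A, x + x = 0) ∧ ∀ a : Fin 3 → A, f a = a 0 + a 1 + a 2

end Operation

/-- A clone on `A`: a family of finitary operations of positive arity on `A` that contains all
projections and is closed under composition. -/
@[ext]
structure OperationClone (A : Type*) where
  /-- the `n`-ary members of the clone -/
  ops : (n : ℕ) → Set (Operation A n)
  arity_pos : ∀ {n : ℕ} {f : Operation A n}, f ∈ ops n → 0 < n
  proj_mem : ∀ {n : ℕ} (i : Fin n), Operation.proj A i ∈ ops n
  comp_mem : ∀ {n m : ℕ} {f : Operation A n} {g : Fin n → Operation A m},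
    f ∈ ops n → (∀ i, g i ∈ ops m) → f.comp g ∈ ops m

namespace OperationClone

variable {A : Type*}

/-- Clones are ordered by inclusion. -/
instance : PartialOrder (OperationClone A) :=
  PartialOrder.lift OperationClone.ops (fun _ _ h => OperationClone.ext h)

/-- The clone of projections. -/
def projections (A : Type*) : OperationClone A where
  ops _ := {f | f.IsProjection}
  arity_pos := by
    rintro n f ⟨i, -⟩
    exact i.pos
  proj_mem i := ⟨i, rfl⟩
  comp_mem := by
    rintro n m f g ⟨i, rfl⟩ hg
    exact hg i

/-- A clone is minimal if it has exactly one proper subclone, the clone of projections. -/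
def IsMinimal (C : OperationClone A) : Prop :=
  ∀ D : OperationClone A, D < C ↔ D = projections A

/-- `C` is generated by `f`: it is the least clone that contains `f`. -/
def IsGeneratedBy (C : OperationClone A) {n : ℕ} (f : Operation A n) : Prop :=
  IsLeast {D : OperationClone A | f ∈ D.ops n} C

/-- Every operation of positive arity generates a clone. -/
theorem exists_isGeneratedBy {n : ℕ} (hn : 0 < n) (f : Operation A n) :
    ∃ C : OperationClone A, C.IsGeneratedBy f := by
  refine ⟨⟨fun m => {g | 0 < m ∧ ∀ D : OperationClone A, f ∈ D.ops n → g ∈ D.ops m},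
    fun h => h.1, fun i => ⟨i.pos, fun D _ => D.proj_mem i⟩, ?_⟩, ⟨hn, fun D hD => hD⟩, ?_⟩
  · intro k m h g hh hg
    exact ⟨(hg ⟨0, hh.1⟩).1, fun D hD => D.comp_mem (hh.2 D hD) fun i => (hg i).2 D hD⟩
  · intro D hD m g hg
    exact hg.2 D hD

end OperationClone

/-- The clone generated by `f` is minimal. -/
def Operation.GeneratesMinimalClone {A : Type*} {n : ℕ} (f : Operation A n) : Prop :=
  ∃ C : OperationClone A, C.IsGeneratedBy f ∧ C.IsMinimal

/-! A member of a minimal clone that is not a projection generates it, so a generator may be taken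
of least arity `n`; identifying two of its variables then gives a projection. For `n = 1` some
iterate is a retraction or a permutation of prime order; for `n = 2` the generator is idempotent.
For `n = 3` the three identifications leave a majority operation, a minority operation, a
semiprojection, or an operation from which a majority operation can be composed. For `n ≥ 4`
Świerczkowski's lemma, `exists_eq_of_identification`, yields a semiprojection.

The minority case rests on `IsMinority.eq_of_eqOn_pair`. On a pair `{a, b}` a minority operation is
the sum `x + y + z` in `ZMod 2`, and in a minimal clone identities pass from the pair to all of `A`,
the group laws among them. Conversely, any non-projection in the affine clone of an elementary
abelian 2-group gives back `x + y + z` when variables are identified. -/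

namespace OperationClone

variable {A : Type*}

theorem le_iff {C D : OperationClone A} :
    C ≤ D ↔ ∀ (n : ℕ) (f : Operation A n), f ∈ C.ops n → f ∈ D.ops n := Iff.rfl

theorem projections_le (C : OperationClone A) : projections A ≤ C := by
  rintro n f ⟨i, rfl⟩
  exact C.proj_mem i

/-- The intersection of two clones. -/
def inter (C D : OperationClone A) : OperationClone A where
  ops n := C.ops n ∩ D.ops n
  arity_pos h := C.arity_pos h.1
  proj_mem i := ⟨C.proj_mem i, D.proj_mem i⟩
  comp_mem hf hg := ⟨C.comp_mem hf.1 fun i => (hg i).1, D.comp_mem hf.2 fun i => (hg i).2⟩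

theorem IsGeneratedBy.le {C D : OperationClone A} {n : ℕ} {f : Operation A n}
    (hC : C.IsGeneratedBy f) (hD : f ∈ D.ops n) : C ≤ D := hC.2 hD

/-- A minimal clone is generated by each of its members that is not a projection. -/
theorem IsMinimal.isGeneratedBy {C : OperationClone A} (hC : C.IsMinimal) {n : ℕ}
    {g : Operation A n} (hg : g ∈ C.ops n) (hg' : ¬ g.IsProjection) : C.IsGeneratedBy g := by
  refine ⟨hg, fun D hD => ?_⟩
  have hle : C.inter D ≤ C := fun n f h => h.1
  rcases hle.lt_or_eq with h | h
  · rw [hC] at h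
    have : g ∈ (C.inter D).ops n := ⟨hg, hD⟩
    rw [h] at this
    exact absurd this hg'
  · rw [← h]
    exact fun n f h => h.2

/-- A minimal clone has a member that is not a projection. -/
theorem IsMinimal.exists_not_isProjection {C : OperationClone A} (hC : C.IsMinimal) :
    ∃ (n : ℕ) (f : Operation A n), f ∈ C.ops n ∧ ¬ f.IsProjection := by
  by_contra! h
  exact lt_irrefl _ (((hC _).2 rfl).trans_le (le_iff.2 h))

/-! ### Three clones used for comparison -/

/-- The clone of the operations that depend on one variable only, through an iterate of `f`. -/
def iterates (f : A → A) : OperationClone A where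
  ops n := {g | ∃ (i : Fin n) (k : ℕ), g = fun a => f^[k] (a i)}
  arity_pos := by
    rintro n g ⟨i, -⟩
    exact i.pos
  proj_mem i := ⟨i, 0, rfl⟩
  comp_mem := by
    rintro n m _ g ⟨i, k, rfl⟩ hg
    obtain ⟨j, l, h⟩ := hg i
    refine ⟨j, k + l, ?_⟩
    funext a
    simp [Operation.comp, h, Function.iterate_add_apply]

theorem iterate_mem {D : OperationClone A} {g : A → A}
    (h : (fun a => g (a 0) : Operation A 1) ∈ D.ops 1) (j : ℕ) :
    (fun a => g^[j] (a 0) : Operation A 1) ∈ D.ops 1 := by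
  induction j with
  | zero => exact D.proj_mem 0
  | succ j ih =>
    have := D.comp_mem ih (g := fun _ => (fun a => g (a 0) : Operation A 1)) fun _ => h
    exact this

/-- The clone of the operations whose restriction to `{a, b}` is a projection. -/
def projectionsOn (a b : A) : OperationClone A where
  ops n := {g | ∃ i : Fin n, ∀ y : Fin n → A, (∀ j, y j = a ∨ y j = b) → g y = y i}
  arity_pos := by
    rintro n g ⟨i, -⟩
    exact i.pos
  proj_mem i := ⟨i, fun _ _ => rfl⟩
  comp_mem := by
    rintro n m f g ⟨i, hf⟩ hg
    choose k hk using hg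
    refine ⟨k i, fun y hy => ?_⟩
    rw [Operation.comp, hf, hk i y hy]
    intro j
    rw [hk j y hy]
    exact hy _

/-- The clone of the idempotent affine operations of a vector space over `ZMod 2`. -/
def affine (A : Type*) [AddCommGroup A] [Module (ZMod 2) A] : OperationClone A where
  ops n := {g | ∃ c : Fin n → ZMod 2, ∑ i, c i = 1 ∧ ∀ a, g a = ∑ i, c i • a i}
  arity_pos := by
    rintro n g ⟨c, hc, -⟩
    rcases Nat.eq_zero_or_pos n with rfl | h
    · simp at hc
    · exact h
  proj_mem i := ⟨Pi.single i 1, by simp, fun a => by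
    simp [Operation.proj, Pi.single_apply, ite_smul]⟩
  comp_mem := by
    rintro n m f g ⟨c, hc, hf⟩ hg
    choose d hd hg using hg
    refine ⟨fun j => ∑ i, c i * d i j, ?_, fun a => ?_⟩
    · rw [Finset.sum_comm]
      simp [← Finset.mul_sum, hd, hc]
    · simp only [Operation.comp, hf, hg, Finset.smul_sum, Finset.sum_smul, mul_smul]
      exact Finset.sum_comm

end OperationClone

/-! ### Types (I) and (V) generate minimal clones -/

namespace Operation

variable {A : Type*} {n : ℕ}

/-- If `f` is not a projection and belongs to a clone in which `f` is generated by every member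
that is not a projection, then `f` generates a minimal clone. -/
theorem generatesMinimalClone_of_mem {f : Operation A n} (hf : ¬ f.IsProjection)
    (E : OperationClone A) (hE : f ∈ E.ops n)
    (h : ∀ (D : OperationClone A) (m : ℕ) (g : Operation A m), g ∈ E.ops m →
      ¬ g.IsProjection → g ∈ D.ops m → f ∈ D.ops n) :
    f.GeneratesMinimalClone := by
  obtain ⟨C, hC⟩ := OperationClone.exists_isGeneratedBy (E.arity_pos hE) f
  refine ⟨C, hC, fun D => ⟨fun hD => ?_, ?_⟩⟩
  · refine le_antisymm (fun m g hg => ?_) D.projections_le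
    by_contra hg'
    exact hD.not_ge (hC.le (h D m g (hC.le hE m (hD.le m hg)) hg' hg))
  · rintro rfl
    refine C.projections_le.lt_of_ne ?_
    rintro rfl
    exact hf hC.1

theorem eq_toMap (f : Operation A 1) : f = fun a => f.toMap (a 0) := by
  funext a
  rw [toMap]
  congr 1
  funext i
  rw [Fin.fin_one_eq_zero i]
  rfl

theorem isProjection_iff_toMap_eq_id {f : Operation A 1} : f.IsProjection ↔ f.toMap = id := by
  constructor
  · rintro ⟨i, rfl⟩
    rw [Fin.fin_one_eq_zero i]
    rfl
  · intro h
    refine ⟨0, ?_⟩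
    rw [f.eq_toMap, h]
    rfl

/-- All non-projections in the clone of iterates are non-identity iterates of `f` applied to one
variable, so it is enough to recover `f` by iterating each of these. -/
theorem generatesMinimalClone_of_toMap {f : Operation A 1} (hf : f.toMap ≠ id)
    (h : ∀ k : ℕ, f.toMap^[k] ≠ id → ∃ j : ℕ, (f.toMap^[k])^[j] = f.toMap) :
    f.GeneratesMinimalClone := by
  refine generatesMinimalClone_of_mem (mt isProjection_iff_toMap_eq_id.1 hf)
    (OperationClone.iterates f.toMap) ⟨0, 1, f.eq_toMap⟩ ?_
  rintro D m g ⟨i, k, rfl⟩ hg hD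
  obtain ⟨j, hj⟩ := h k fun h => hg ⟨i, by rw [h]; rfl⟩
  have hk : (fun a => f.toMap^[k] (a 0) : Operation A 1) ∈ D.ops 1 :=
    D.comp_mem hD (g := fun _ => proj A 0) fun _ => D.proj_mem _
  rw [f.eq_toMap, ← hj]
  exact OperationClone.iterate_mem hk j

/-- A retraction has no iterates but itself and the identity. For a permutation of prime order, an
exponent giving a non-identity power is coprime to the order, so that power generates the same
cyclic group. -/
theorem IsUnaryRetractionOrPrimePerm.generatesMinimalClone {f : Operation A 1}
    (hf : f.IsUnaryRetractionOrPrimePerm) : f.GeneratesMinimalClone := by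
  rcases hf with ⟨hf, hr⟩ | ⟨σ, hσ, hp⟩
  · refine generatesMinimalClone_of_toMap (fun h => hr (by simp [h])) fun k hk => ⟨1, ?_⟩
    have key : ∀ k : ℕ, f.toMap^[k + 1] = f.toMap := by
      intro k
      induction k with
      | zero => rfl
      | succ k ih => rw [Function.iterate_succ, ih, hf]
    cases k with
    | zero => exact absurd rfl hk
    | succ k => exact key k
  · refine generatesMinimalClone_of_toMap (fun h => ?_) fun k hk => ?_
    · have : σ = 1 := by
        ext x
        simp [hσ, h]
      rw [this, orderOf_one] at hp
      exact Nat.not_prime_one hp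
    · rw [← hσ, ← Equiv.Perm.coe_pow] at hk
      have hk' : ¬ orderOf σ ∣ k := by
        rw [orderOf_dvd_iff_pow_eq_one]
        intro h
        exact hk (by rw [h]; rfl)
      have hc : (orderOf σ).Coprime k := (Nat.Prime.coprime_iff_not_dvd hp).2 hk'
      obtain ⟨j, hj⟩ := exists_pow_eq_self_of_coprime hc.symm
      refine ⟨j, ?_⟩
      rw [← hσ, ← Equiv.Perm.coe_pow, ← Equiv.Perm.coe_pow, hj]

theorem IsElementaryTwoGroupAddition.generatesMinimalClone [Nontrivial A] {f : Operation A 3}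
    (hf : f.IsElementaryTwoGroupAddition) : f.GeneratesMinimalClone := by
  obtain ⟨_, h2, hf⟩ := hf
  let _ : Module (ZMod 2) A := AddCommGroup.zmodModule fun x => by rw [two_nsmul, h2]
  refine generatesMinimalClone_of_mem ?_ (OperationClone.affine A)
    ⟨fun _ => 1, by decide, fun a => by simp [hf, Fin.sum_univ_three]⟩ ?_
  · rintro ⟨i, hi⟩
    obtain ⟨b, hb⟩ := exists_ne (0 : A)
    have h1 := hf (fun j => if j = i + 1 then b else 0)
    rw [hi] at h1
    fin_cases i <;> simp [proj] at h1 <;> exact hb h1.symm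
  · rintro D m g ⟨c, hc, hg⟩ hgp hgD
    have hz : ∀ x : ZMod 2, x ≠ 0 → x = 1 := by decide
    obtain ⟨i, hi⟩ : ∃ i, c i ≠ 0 := by
      by_contra! h
      simp [h] at hc
    obtain ⟨j, hji, hj⟩ : ∃ j, j ≠ i ∧ c j ≠ 0 := by
      by_contra! h
      refine hgp ⟨i, funext fun a => ?_⟩
      rw [hg, Finset.sum_eq_single i (fun j _ hj => by rw [h j hj, zero_smul]) (by simp),
        hz _ hi, one_smul]
      rfl
    -- The coefficients sum to 1 and those at `i` and `j` are 1, so the remaining ones sum to 1 in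
    -- `ZMod 2`. Merging all the other variables therefore leaves `x + y + z`.
    let s : Fin m → Fin 3 := fun k => if k = i then 0 else if k = j then 1 else 2
    have hs : f = g.comp fun k => proj A (s k) := by
      funext a
      have h1 : ∀ k, c k • a (s k) = c k • a 2 + ((if k = i then a 0 + a 2 else 0) +
          (if k = j then a 1 + a 2 else 0)) := by
        intro k
        by_cases hki : k = i
        · subst hki
          rw [hz _ hi]
          simp [s, hji.symm, add_comm (a 0), ← add_assoc, h2]
        · by_cases hkj : k = j
          · subst hkj
            rw [hz _ hj]
            simp [s, hki, add_comm (a 1), ← add_assoc, h2]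
          · simp [s, hki, hkj]
      rw [comp, hg, hf]
      simp only [proj]
      rw [Finset.sum_congr rfl fun k _ => h1 k, Finset.sum_add_distrib, Finset.sum_add_distrib,
        ← Finset.sum_smul, hc]
      simp only [one_smul, Finset.sum_ite_eq', Finset.mem_univ, if_true]
      have := h2 (a 2)
      calc a 0 + a 1 + a 2 = a 0 + a 1 + a 2 + (a 2 + a 2) := by rw [this, add_zero]
        _ = _ := by abel
    rw [hs]
    exact D.comp_mem hgD fun k => D.proj_mem _

/-! ### Minority operations -/

/-- In a minimal clone with a minority operation, two operations are equal as soon as they agree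
on a two-element set. -/
theorem IsMinority.eq_of_eqOn_pair {f : Operation A 3} (hf : f.IsMinority) {C : OperationClone A}
    (hC : C.IsMinimal) (hfC : f ∈ C.ops 3) {a b : A} (hab : a ≠ b) {s t : Operation A n}
    (hs : s ∈ C.ops n) (ht : t ∈ C.ops n)
    (h : ∀ y : Fin n → A, (∀ j, y j = a ∨ y j = b) → s y = t y) : s = t := by
  let up (u : Operation A n) : Operation A (n + 1) := u.comp fun i => proj A i.castSucc
  have hup : ∀ {u}, u ∈ C.ops n → up u ∈ C.ops (n + 1) :=
    fun hu => C.comp_mem hu fun i => C.proj_mem _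
  -- The new last variable `z` gives `g = f(s, t, z)`, which equals `z` on `{a, b}`. If `g` were not
  -- a projection it would generate `f`, which is no projection on `{a, b}`.
  let g : Operation A (n + 1) := f.comp ![up s, up t, proj A (Fin.last n)]
  have hg : ∀ y, g y = f ![s fun i => y i.castSucc, t fun i => y i.castSucc, y (Fin.last n)] := by
    intro y
    simp only [g, comp]
    congr 1
    funext i
    fin_cases i <;> rfl
  have hgC : g ∈ C.ops (n + 1) := by
    refine C.comp_mem hfC fun i => ?_
    fin_cases i
    exacts [hup hs, hup ht, C.proj_mem _]
  have hgl : ∀ y : Fin (n + 1) → A, (∀ j, y j = a ∨ y j = b) → g y = y (Fin.last n) := by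
    intro y hy
    rw [hg, h _ fun j => hy _]
    exact (hf _ _).2.2
  have hgp : g.IsProjection := by
    by_contra hgp
    obtain ⟨i, hi⟩ := (hC.isGeneratedBy hgC hgp).le
      (show g ∈ (OperationClone.projectionsOn a b).ops _ from ⟨_, hgl⟩) 3 hfC
    have h1 := hi ![a, b, b] (by intro j; fin_cases j <;> simp)
    have h2 := hi ![b, a, b] (by intro j; fin_cases j <;> simp)
    have h3 := hi ![b, b, a] (by intro j; fin_cases j <;> simp)
    rw [(hf a b).1] at h1
    rw [(hf a b).2.1] at h2
    rw [(hf a b).2.2] at h3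
    fin_cases i
    exacts [hab h2, hab h1, hab h1]
  obtain ⟨i, hi⟩ := hgp
  have hil : i = Fin.last n := by
    by_contra hne
    classical
    have h1 := hgl (fun j => if j = i then a else b) fun j => by
      by_cases hj : j = i <;> simp [hj]
    rw [hi] at h1
    simp [proj, Ne.symm hne] at h1
    exact hab h1
  subst hil
  funext x
  -- Now `f(s, t, z) = z` everywhere; at `z = s` the minority law makes the left side `t`.
  have h1 := hg (Fin.snoc x (s x))
  rw [hi] at h1
  simp only [proj, Fin.snoc_last, Fin.snoc_castSucc] at h1
  rw [(hf (t x) (s x)).2.1] at h1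
  exact h1

/-- Take `a` as zero and `f(x, y, a)` as `x + y`. The identities needed hold for sums in `ZMod 2`,
hence on `{a, b}`, and `eq_of_eqOn_pair` extends them to `A`. -/
theorem IsMinority.isElementaryTwoGroupAddition [Nontrivial A] {f : Operation A 3}
    (hf : f.IsMinority) (hmin : f.GeneratesMinimalClone) : f.IsElementaryTwoGroupAddition := by
  obtain ⟨C, hgen, hC⟩ := hmin
  obtain ⟨a, b, hab⟩ := exists_pair_ne A
  have hfC : f ∈ C.ops 3 := hgen.1
  have h1 : ∀ x y, f ![x, y, y] = x := fun x y => (hf x y).1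
  have h2 : ∀ x y, f ![y, x, y] = x := fun x y => (hf x y).2.1
  have h3 : ∀ x y, f ![y, y, x] = x := fun x y => (hf x y).2.2
  have hcomp : ∀ {m : ℕ} {u v w : Operation A m}, u ∈ C.ops m → v ∈ C.ops m → w ∈ C.ops m →
      (fun y => f ![u y, v y, w y]) ∈ C.ops m := by
    intro m u v w hu hv hw
    have := C.comp_mem hfC (g := ![u, v, w]) fun i => by
      fin_cases i
      exacts [hu, hv, hw]
    convert this using 1
    funext y
    simp only [comp]
    congr 1
    funext i
    fin_cases i <;> rfl
  have hp : ∀ {m : ℕ} (i : Fin m), (fun y => y i : Operation A m) ∈ C.ops m :=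
    fun i => C.proj_mem i
  have hcomm : ∀ x y z, f ![x, y, z] = f ![y, x, z] := by
    intro x y z
    have := hf.eq_of_eqOn_pair hC hfC hab (hcomp (hp (0 : Fin 3)) (hp 1) (hp 2))
      (hcomp (hp (1 : Fin 3)) (hp 0) (hp 2)) fun y hy => by
        rcases hy 0 with e0 | e0 <;> rcases hy 1 with e1 | e1 <;> rcases hy 2 with e2 | e2 <;>
          simp only [e0, e1, e2, h1, h2, h3]
    exact congrFun this ![x, y, z]
  have hassoc : ∀ x y z o, f ![f ![x, y, o], z, o] = f ![x, f ![y, z, o], o] := by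
    intro x y z o
    have := hf.eq_of_eqOn_pair hC hfC hab
      (hcomp (hcomp (hp (0 : Fin 4)) (hp 1) (hp 3)) (hp 2) (hp 3))
      (hcomp (hp (0 : Fin 4)) (hcomp (hp 1) (hp 2) (hp 3)) (hp 3)) fun y hy => by
        rcases hy 0 with e0 | e0 <;> rcases hy 1 with e1 | e1 <;> rcases hy 2 with e2 | e2 <;>
          rcases hy 3 with e3 | e3 <;> simp only [e0, e1, e2, e3, h1, h2, h3]
    exact congrFun this ![x, y, z, o]
  have hsum : ∀ x y z o, f ![x, y, z] = f ![f ![x, y, o], z, o] := by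
    intro x y z o
    have := hf.eq_of_eqOn_pair hC hfC hab
      (hcomp (hp (0 : Fin 4)) (hp 1) (hp 2))
      (hcomp (hcomp (hp (0 : Fin 4)) (hp 1) (hp 3)) (hp 2) (hp 3)) fun y hy => by
        rcases hy 0 with e0 | e0 <;> rcases hy 1 with e1 | e1 <;> rcases hy 2 with e2 | e2 <;>
          rcases hy 3 with e3 | e3 <;> simp only [e0, e1, e2, e3, h1, h2, h3]
    exact congrFun this ![x, y, z, o]
  let _ : Add A := ⟨fun x y => f ![x, y, a]⟩
  let _ : Zero A := ⟨a⟩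
  let _ : Neg A := ⟨fun x => x⟩
  refine ⟨{ nsmul := nsmulRec
            zsmul := zsmulRec
            add_assoc := fun x y z => hassoc x y z a
            zero_add := fun x => h2 x a
            add_zero := fun x => h1 x a
            neg_add_cancel := fun x => h3 a x
            add_comm := fun x y => hcomm x y a }, fun x => h3 a x, fun y => ?_⟩
  refine Eq.trans ?_ (hsum (y 0) (y 1) (y 2) a)
  congr 1
  funext i
  fin_cases i <;> rfl

/-! ### Świerczkowski's lemma -/

/-- If each identification of two variables turns an operation of arity at least four into a
projection, then these projections are all onto the same variable. -/
theorem exists_eq_of_identification [Nontrivial A] (hn : 4 ≤ n) {f : Operation A n}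
    (h : ∀ i j : Fin n, i ≠ j → ∃ k, ∀ y : Fin n → A, y i = y j → f y = y k) :
    ∃ k, ∀ y : Fin n → A, (∃ i j, i ≠ j ∧ y i = y j) → f y = y k := by
  classical
  obtain ⟨a, b, hab⟩ := exists_pair_ne A
  choose! k hk using h
  -- Evaluate `f` at the point that is `a` on `S` and `b` off `S`: its value tells whether the
  -- selected variable lies in `S`, and both identifications apply there.
  have key : ∀ (S : Finset (Fin n)) {i j p q : Fin n}, i ≠ j → p ≠ q → (i ∈ S ↔ j ∈ S) →
      (p ∈ S ↔ q ∈ S) → (k i j ∈ S ↔ k p q ∈ S) := by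
    intro S i j p q hij hpq h1 h2
    have e1 := hk i j hij (fun m => if m ∈ S then a else b) (by simp [h1])
    have e2 := hk p q hpq (fun m => if m ∈ S then a else b) (by simp [h2])
    rw [e1] at e2
    by_cases u : k i j ∈ S <;> by_cases v : k p q ∈ S <;> simp_all
  by_cases hB : ∃ i j, i ≠ j ∧ k i j ≠ i ∧ k i j ≠ j
  · obtain ⟨i, j, hij, hi, hj⟩ := hB
    set c := k i j with hc
    have hout : ∀ p q, p ≠ q → p ≠ c → q ≠ c → k p q = c := by
      intro p q hpq hp hq
      have := key {c} hij hpq (by simp [hi.symm, hj.symm]) (by simp [hp, hq])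
      simpa [← hc] using this
    have hin : ∀ q, q ≠ c → k c q = c ∨ k c q = q := by
      intro q hq
      by_cases hqi : q = i ∨ q = j
      · obtain ⟨o, hoq, hoc, ho⟩ : ∃ o, o ≠ q ∧ o ≠ c ∧ (o = i ∨ o = j) := by
          rcases hqi with rfl | rfl
          exacts [⟨j, hij.symm, hj.symm, .inr rfl⟩, ⟨i, hij, hi.symm, .inl rfl⟩]
        -- The arity bound supplies a fourth index, hence a pair `o, l` disjoint from `{c, q}`, to
        -- be compared with `c, q` in `key`.
        obtain ⟨l, hl⟩ : ∃ l, l ∉ ({c, q, o} : Finset (Fin n)) := by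
          by_contra! hl
          have h1 := Finset.card_le_card (fun x _ => hl x : (Finset.univ : Finset (Fin n)) ⊆ _)
          have h2 := Finset.card_le_three (a := c) (b := q) (c := o)
          rw [Finset.card_univ, Fintype.card_fin] at h1
          omega
        simp only [Finset.mem_insert, Finset.mem_singleton, not_or] at hl
        have e := hout o l (Ne.symm hl.2.2) hoc hl.1
        have := key {c, q} (Ne.symm hl.2.2) (Ne.symm hq) (by simp [hoq, hoc, hl]) (by simp)
        simpa [e] using this
      · push Not at hqi
        have := key {c, q} hij (Ne.symm hq)
          (by simp [hi.symm, hj.symm, hqi.1.symm, hqi.2.symm]) (by simp)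
        simpa [← hc] using this
    have hin' : ∀ q, q ≠ c → ∀ y : Fin n → A, y c = y q → f y = y c := by
      intro q hq y hy
      rw [hk c q (Ne.symm hq) y hy]
      rcases hin q hq with e | e <;> rw [e]
      exact hy.symm
    refine ⟨c, ?_⟩
    rintro y ⟨p, q, hpq, hy⟩
    by_cases hp : p = c
    · exact hin' q (by rw [← hp]; exact hpq.symm) y (by rw [← hp]; exact hy)
    · by_cases hq : q = c
      · exact hin' p hp y (by rw [← hq]; exact hy.symm)
      · rw [hk p q hpq y hy, hout p q hpq hp hq]
  -- Here each identification selects one of the two merged variables, so the disjoint pairs `{0,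
  -- 1}` and `{2, 3}` contradict `key` for `S = {0, 1}`.
  · push Not at hB
    exfalso
    let v : Fin 4 → Fin n := Fin.castLE hn
    have hv : Function.Injective v := Fin.castLE_injective hn
    have h01 : v 0 ≠ v 1 := hv.ne (by decide)
    have h23 : v 2 ≠ v 3 := hv.ne (by decide)
    have h02 : v 2 ≠ v 0 := hv.ne (by decide)
    have h12 : v 2 ≠ v 1 := hv.ne (by decide)
    have h03 : v 3 ≠ v 0 := hv.ne (by decide)
    have h13 : v 3 ≠ v 1 := hv.ne (by decide)
    have := key {v 0, v 1} h01 h23 (by simp) (by simp [h02, h12, h03, h13])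
    have e1 := hB _ _ h01
    have e2 := hB _ _ h23
    by_cases e : k (v 0) (v 1) = v 0 <;> by_cases e' : k (v 2) (v 3) = v 2 <;> simp_all

theorem IsMajority.not_isProjection [Nontrivial A] {f : Operation A 3} (hf : f.IsMajority) :
    ¬ f.IsProjection := by
  rintro ⟨i, rfl⟩
  obtain ⟨a, b, hab⟩ := exists_pair_ne A
  obtain ⟨h1, h2, h3⟩ := hf a b
  fin_cases i
  exacts [hab h3.symm, hab h2.symm, hab h1.symm]

end Operation

/-! ### Finding a generator of one of the five types -/

namespace OperationClone

variable {A : Type*} {n : ℕ}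

/-- If all members of smaller arity are projections, then identifying two variables of a member
of a clone gives a projection. -/
theorem exists_eq_of_forall_isProjection {C : OperationClone A} {f : Operation A n}
    (hf : f ∈ C.ops n)
    (hC : ∀ m < n, ∀ g : Operation A m, g ∈ C.ops m → g.IsProjection) {i j : Fin n}
    (hij : i ≠ j) : ∃ k, ∀ y : Fin n → A, y i = y j → f y = y k := by
  obtain ⟨m, rfl⟩ : ∃ m, n = m + 1 := ⟨n - 1, by have := i.pos; omega⟩
  obtain ⟨r, hr⟩ := Fin.exists_succAbove_eq hij
  -- Deletes index `j` and redirects it to `r`, the position of `i` among the remaining indices.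
  let s : Fin (m + 1) → Fin m := j.insertNth r id
  obtain ⟨q, hq⟩ := hC m (Nat.lt_succ_self m) (f.comp fun p => Operation.proj A (s p))
    (C.comp_mem hf fun p => C.proj_mem _)
  refine ⟨j.succAbove q, fun y hy => ?_⟩
  have h1 := congrFun hq fun p => y (j.succAbove p)
  have h2 : (fun p => y (j.succAbove (s p))) = y := by
    funext p
    rcases Fin.eq_self_or_eq_succAbove j p with rfl | ⟨p, rfl⟩
    · simp [s, hr, hy]
    · simp [s]
  simp only [Operation.comp, Operation.proj, h2] at h1
  exact h1

/-- Unless its square is the identity, `f` is generated by that square, so it is a positive even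
iterate of itself. Its iterates thus form a finite cyclic semigroup: either this is a group of
permutations, with an element of prime order, or it contains an idempotent other than the identity.
-/
theorem IsMinimal.exists_unary {C : OperationClone A} (hC : C.IsMinimal) {f : Operation A 1}
    (hf : f ∈ C.ops 1) (hfp : ¬ f.IsProjection) :
    ∃ f : Operation A 1, f.IsUnaryRetractionOrPrimePerm ∧ C.IsGeneratedBy f := by
  let it (k : ℕ) : Operation A 1 := fun a => f.toMap^[k] (a 0)
  have hit : ∀ k, it k ∈ C.ops 1 := fun k => iterate_mem (by rw [← f.eq_toMap]; exact hf) k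
  have hmap : ∀ k, (it k).toMap = f.toMap^[k] := fun k => rfl
  have hgen : ∀ k, f.toMap^[k] ≠ id → C.IsGeneratedBy (it k) := fun k hk =>
    hC.isGeneratedBy (hit k) fun h => hk (Operation.isProjection_iff_toMap_eq_id.1 h)
  have hne : f.toMap ≠ id := fun h => hfp (Operation.isProjection_iff_toMap_eq_id.2 h)
  obtain ⟨k, hk⟩ : ∃ k, f.toMap^[k + 2] = f.toMap ∨ f.toMap^[k + 1] = id := by
    by_cases h2 : f.toMap^[2] = id
    · exact ⟨1, .inr h2⟩
    obtain ⟨i, k, hk⟩ := (hgen 2 h2).le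
      (show it 2 ∈ (iterates (f.toMap^[2])).ops 1 from ⟨0, 1, rfl⟩) 1 hf
    have hk' : f.toMap = f.toMap^[2 * k] := by
      rw [Function.iterate_mul]
      funext x
      exact congrFun hk ![x] |>.trans (by rw [Fin.fin_one_eq_zero i]; rfl)
    cases k with
    | zero => exact absurd hk' hne
    | succ k => exact ⟨2 * k, .inl hk'.symm⟩
  by_cases hid : f.toMap^[k + 1] = id
  · have hl : Function.LeftInverse f.toMap^[k] f.toMap := fun x => by
      rw [← Function.iterate_succ_apply, hid, id]
    have hr : Function.RightInverse f.toMap^[k] f.toMap := fun x => by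
      rw [← Function.iterate_succ_apply' f.toMap, hid, id]
    let σ : Equiv.Perm A := ⟨f.toMap, f.toMap^[k], hl, hr⟩
    have hσ : ⇑σ = f.toMap := rfl
    have hpow : ∀ m : ℕ, ⇑(σ ^ m) = f.toMap^[m] := fun m => by rw [Equiv.Perm.coe_pow, hσ]
    have hfin : IsOfFinOrder σ := isOfFinOrder_iff_pow_eq_one.2
      ⟨k + 1, Nat.succ_pos _, by ext x; rw [hpow, hid]; rfl⟩
    have hne1 : orderOf σ ≠ 1 := by
      rw [Ne, orderOf_eq_one_iff]
      intro h
      exact hne (by rw [← hσ, h]; rfl)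
    obtain ⟨p, hp, d, hd⟩ := Nat.exists_prime_and_dvd hne1
    have hd0 : d ≠ 0 := by
      rintro rfl
      exact hfin.orderOf_pos.ne' (by simpa using hd)
    have hord : orderOf (σ ^ d) = p := by
      rw [orderOf_pow_of_dvd hd0 ⟨p, by rw [hd, mul_comm]⟩, hd]
      exact Nat.mul_div_cancel _ (Nat.pos_of_ne_zero hd0)
    refine ⟨it d, .inr ⟨σ ^ d, hpow d, by rwa [hord]⟩, hgen d fun h => ?_⟩
    rw [← hpow] at h
    have : σ ^ d = 1 := by
      ext x
      rw [h]
      rfl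
    rw [this, orderOf_one] at hord
    exact hp.one_lt.ne hord
  · have hk : f.toMap^[k + 2] = f.toMap := hk.resolve_right hid
    have hidem : f.toMap^[k + 1] ∘ f.toMap^[k + 1] = f.toMap^[k + 1] := by
      rw [← Function.iterate_add, show k + 1 + (k + 1) = k + (k + 2) by ring,
        Function.iterate_add, hk, ← Function.iterate_succ]
    refine ⟨it (k + 1), .inl ⟨hidem, fun h => hid ?_⟩, hgen _ hid⟩
    rw [hmap, Set.range_eq_univ] at h
    funext x
    obtain ⟨y, rfl⟩ := h x
    exact congrFun hidem y

theorem IsMinimal.exists_semiprojection {C : OperationClone A} (hC : C.IsMinimal)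
    {f : Operation A n} (hf : f ∈ C.ops n) {k : Fin n} (hs : f.IsSemiprojection k) :
    ∃ (n : ℕ) (hn : 0 < n) (f : Operation A n),
        f.IsSemiprojection ⟨0, hn⟩ ∧ C.IsGeneratedBy f := by
  obtain ⟨hn, hfp, hs⟩ := hs
  let e : Equiv.Perm (Fin n) := Equiv.swap ⟨0, k.pos⟩ k
  have hgp : ¬ (f.comp fun i => Operation.proj A (e i)).IsProjection := by
    rintro ⟨i, hi⟩
    refine hfp ⟨e.symm i, funext fun y => ?_⟩
    have := congrFun hi fun j => y (e.symm j)
    simpa [Operation.comp, Operation.proj] using this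
  refine ⟨n, k.pos, f.comp fun i => Operation.proj A (e i), ⟨hn, hgp, ?_⟩,
    hC.isGeneratedBy (C.comp_mem hf fun i => C.proj_mem _) hgp⟩
  rintro y ⟨p, q, hpq, hy⟩
  have := hs (fun j => y (e j)) ⟨e.symm p, e.symm q, e.symm.injective.ne hpq, by simpa using hy⟩
  simpa [Operation.comp, Operation.proj, e] using this

/-- The ternary case: all identifications of two variables of `f` give projections. -/
theorem IsMinimal.exists_of_ternary [Nontrivial A] {C : OperationClone A} (hC : C.IsMinimal)
    {f : Operation A 3} (hf : f ∈ C.ops 3) (hfp : ¬ f.IsProjection)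
    (h : ∀ i j : Fin 3, i ≠ j → ∃ k, ∀ y : Fin 3 → A, y i = y j → f y = y k) :
    (∃ (n : ℕ) (hn : 0 < n) (f : Operation A n),
        f.IsSemiprojection ⟨0, hn⟩ ∧ C.IsGeneratedBy f) ∨
      (∃ f : Operation A 3, f.IsMajority ∧ C.IsGeneratedBy f) ∨
      (∃ f : Operation A 3, f.IsElementaryTwoGroupAddition ∧ C.IsGeneratedBy f) := by
  have hsemi : ∀ k : Fin 3, (∀ y : Fin 3 → A, (y 0 = y 1 → f y = y k) ∧ (y 0 = y 2 → f y = y k) ∧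
      (y 1 = y 2 → f y = y k)) → ∃ (n : ℕ) (hn : 0 < n) (f : Operation A n),
        f.IsSemiprojection ⟨0, hn⟩ ∧ C.IsGeneratedBy f := by
    intro k hk
    refine hC.exists_semiprojection hf (k := k) ⟨le_rfl, hfp, ?_⟩
    rintro y ⟨p, q, hpq, hy⟩
    obtain ⟨h1, h2, h3⟩ := hk y
    fin_cases p <;> fin_cases q <;>
      first
      | exact absurd rfl hpq
      | exact h1 hy
      | exact h2 hy
      | exact h3 hy
      | exact h1 hy.symm
      | exact h2 hy.symm
      | exact h3 hy.symm
  have hmaj : ∀ g : Operation A 3, g ∈ C.ops 3 → g.IsMajority →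
      ∃ f : Operation A 3, f.IsMajority ∧ C.IsGeneratedBy f :=
    fun g hg hm => ⟨g, hm, hC.isGeneratedBy hg hm.not_isProjection⟩
  -- These are the laws of a Pixley operation `g`; they make `g(x, g(x, y, z), z)` a majority
  -- operation.
  have hpix : ∀ p q r : Fin 3, (∀ x y : A, (fun a : Fin 3 → A => f ![a p, a q, a r]) ![x, x, y] = y ∧
      (fun a : Fin 3 → A => f ![a p, a q, a r]) ![x, y, x] = x ∧
      (fun a : Fin 3 → A => f ![a p, a q, a r]) ![y, x, x] = y) →
      ∃ f : Operation A 3, f.IsMajority ∧ C.IsGeneratedBy f := by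
    intro p q r hg
    set g : Operation A 3 := fun a => f ![a p, a q, a r] with hgdef
    have hgC : g ∈ C.ops 3 := by
      have := C.comp_mem hf (g := ![Operation.proj A p, Operation.proj A q, Operation.proj A r])
        fun i => by fin_cases i <;> exact C.proj_mem _
      convert this using 1
      funext a
      simp only [Operation.comp, hgdef]
      congr 1
      funext i
      fin_cases i <;> rfl
    have hM := C.comp_mem hgC (g := ![Operation.proj A 0, g, Operation.proj A 2])
        fun i => by
          fin_cases i
          exacts [C.proj_mem _, hgC, C.proj_mem _]
    have hval : ∀ a, g.comp ![Operation.proj A 0, g, Operation.proj A 2] a =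
        g ![a 0, g a, a 2] := by
      intro a
      rw [Operation.comp]
      congr 1
      funext i
      fin_cases i <;> rfl
    refine hmaj _ hM fun x y => ?_
    obtain ⟨h1, h2, h3⟩ := hg x y
    obtain ⟨h1', h2', h3'⟩ := hg y x
    refine ⟨?_, ?_, ?_⟩ <;> rw [hval]
    · rw [h1]
      exact h3'
    · rw [h2]
      exact (hg x x).1
    · rw [h3]
      exact h1'
  obtain ⟨k₁, h₁⟩ := h 0 1 (by decide)
  obtain ⟨k₂, h₂⟩ := h 0 2 (by decide)
  obtain ⟨k₃, h₃⟩ := h 1 2 (by decide)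
  have c₁ : (∀ y : Fin 3 → A, y 0 = y 1 → f y = y 0) ∨ (∀ y : Fin 3 → A, y 0 = y 1 → f y = y 2) := by
    fin_cases k₁
    exacts [.inl h₁, .inl fun y hy => (h₁ y hy).trans hy.symm, .inr h₁]
  have c₂ : (∀ y : Fin 3 → A, y 0 = y 2 → f y = y 0) ∨ (∀ y : Fin 3 → A, y 0 = y 2 → f y = y 1) := by
    fin_cases k₂
    exacts [.inl h₂, .inr h₂, .inl fun y hy => (h₂ y hy).trans hy.symm]
  have c₃ : (∀ y : Fin 3 → A, y 1 = y 2 → f y = y 1) ∨ (∀ y : Fin 3 → A, y 1 = y 2 → f y = y 0) := by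
    fin_cases k₃
    exacts [.inr h₃, .inl h₃, .inl fun y hy => (h₃ y hy).trans hy.symm]
  clear h₁ h₂ h₃
  -- Count the identifications that select the repeated variable: three give a majority operation,
  -- two a semiprojection, one a Pixley operation up to permuting variables, none a minority
  -- operation.
  rcases c₁ with h₁ | h₁ <;> rcases c₂ with h₂ | h₂ <;> rcases c₃ with h₃ | h₃
  · exact .inr (.inl (hmaj f hf fun x y => ⟨h₁ _ rfl, h₂ _ rfl, h₃ _ rfl⟩))
  · exact .inl (hsemi 0 fun y => ⟨h₁ y, h₂ y, h₃ y⟩)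
  · exact .inl (hsemi 1 fun y => ⟨fun e => (h₁ y e).trans e, h₂ y, h₃ y⟩)
  · exact .inr (.inl (hpix 0 2 1 fun x y => ⟨h₂ _ rfl, h₁ _ rfl, h₃ _ rfl⟩))
  · exact .inl (hsemi 2 fun y => ⟨h₁ y, fun e => (h₂ y e).trans e, fun e => (h₃ y e).trans e⟩)
  · exact .inr (.inl (hpix 0 1 2 fun x y => ⟨h₁ _ rfl, h₂ _ rfl, h₃ _ rfl⟩))
  · exact .inr (.inl (hpix 1 0 2 fun x y => ⟨h₁ _ rfl, h₃ _ rfl, h₂ _ rfl⟩))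
  · have hgen := hC.isGeneratedBy hf hfp
    have hmin : f.IsMinority := fun x y => ⟨h₃ _ rfl, h₂ _ rfl, h₁ _ rfl⟩
    exact .inr (.inr ⟨f, hmin.isElementaryTwoGroupAddition ⟨C, hgen, hC⟩, hgen⟩)

end OperationClone

theorem mainTheorem2 (A : Type*) [Nontrivial A] :
    (∀ f : Operation A 3, f.IsMinority →
      (f.GeneratesMinimalClone ↔ f.IsElementaryTwoGroupAddition)) ∧
    (∀ C : OperationClone A, C.IsMinimal →
      (∃ f : Operation A 1, f.IsUnaryRetractionOrPrimePerm ∧ C.IsGeneratedBy f) ∨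
      (∃ f : Operation A 2, f.IsIdempotent ∧ ¬ f.IsProjection ∧ C.IsGeneratedBy f) ∨
      (∃ (n : ℕ) (hn : 0 < n) (f : Operation A n),
        f.IsSemiprojection ⟨0, hn⟩ ∧ C.IsGeneratedBy f) ∨
      (∃ f : Operation A 3, f.IsMajority ∧ C.IsGeneratedBy f) ∨
      (∃ f : Operation A 3, f.IsElementaryTwoGroupAddition ∧ C.IsGeneratedBy f)) ∧
    (∀ f : Operation A 1, f.IsUnaryRetractionOrPrimePerm → f.GeneratesMinimalClone) ∧
    (∀ f : Operation A 3, f.IsElementaryTwoGroupAddition → f.GeneratesMinimalClone) := by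
  refine ⟨fun f hf => ⟨hf.isElementaryTwoGroupAddition, fun h => h.generatesMinimalClone⟩, ?_,
    fun f hf => hf.generatesMinimalClone, fun f hf => hf.generatesMinimalClone⟩
  intro C hC
  classical
  have hex := hC.exists_not_isProjection
  obtain ⟨f, hf, hfp⟩ := Nat.find_spec hex
  have hsmall : ∀ m < Nat.find hex, ∀ g : Operation A m, g ∈ C.ops m → g.IsProjection := by
    intro m hm g hg
    by_contra hgp
    exact Nat.find_min hex hm ⟨g, hg, hgp⟩
  generalize Nat.find hex = n at f hf hfp hsmall
  have hn := C.arity_pos hf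
  have hid := fun i j (hij : i ≠ j) =>
    OperationClone.exists_eq_of_forall_isProjection hf hsmall (i := i) (j := j) hij
  obtain rfl | rfl | rfl | hn4 : n = 1 ∨ n = 2 ∨ n = 3 ∨ 4 ≤ n := by omega
  · exact .inl (hC.exists_unary hf hfp)
  · obtain ⟨k, hk⟩ := hid 0 1 (by decide)
    exact .inr (.inl ⟨f, fun x => hk _ rfl, hfp, hC.isGeneratedBy hf hfp⟩)
  · exact .inr (.inr (hC.exists_of_ternary hf hfp hid))
  · obtain ⟨k, hk⟩ := Operation.exists_eq_of_identification hn4 hid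
    exact .inr (.inr (.inl (hC.exists_semiprojection hf ⟨by omega, hfp, hk⟩)))
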